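/- Let $\alpha\in(0,1)$, $\sigma>0$, $\mathcal H=\{2^{-1},2^{-2},2^{-3},\dots\}$, and for $h\in\mathcal H$ let $n_h=1/(2h)$, $\mathcal G_h=\{h,3h,\dots,1-h\}$ and $\sigma_h=\sigma\sqrt{2/h}$. For $\Theta=(\theta_{h,t})_{h\in\mathcal H,\,t\in\mathcal G_h}$ let $\mathbf P_\Theta$ be the law of the observations $$\hat\theta_{h,t}=\theta_{h,t}+\sigma_h\xi_{h,t},\qquad \xi_{h,t}\ \text{i.i.d.}\ \mathcal N(0,1).$$ Let $\Phi$ be the standard normal distribution function, $S(x)=1/\Phi(x)-1$, $q_\alpha^\varkappa=-\log\log\frac1{1-\alpha}$, and $$Z_h^M=\max_{t\in\mathcal G_h}\log\Bigl[\frac1{n_h}S\Bigl(\frac{\hat\theta_{h,t}}{\sigma_h}\Bigr)\Bigr].$$ For a probability distribution $\bar\pi$ on $\mathcal H$, the MAP test rejects when $\sup_{h}\{Z_h^M+\log\bar\pi_h\}\ge q_\alpha^\varkappa$ (with $\log 0=-\infty$). For $\rho\in\mathcal H$, $\tau\in\mathcal G_\rho$, $a\ge0$ let $\Theta_{\rho,\tau}(a)$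 be the set of all $\Theta$ with $\theta_{\rho,\tau}=-a$ and $\theta_{h,t}\ge0$ for $(h,t)\ne(\rho,\tau)$, and define the type II error and its average, for $\mathbf A=(A_h)_{h\in\mathcal H}$ with $A_h\ge0$, by $$\beta^M_{\rho,\tau}(a)=\sup_{\Theta\in\Theta_{\rho,\tau}(a)}\mathbf P_\Theta\Bigl\{\sup_h\,[Z_h^M+\log\bar\pi_h]\le q_\alpha^\varkappa\Bigr\},\qquad \bar\beta^M_{\bar\pi}(\mathbf A)=\sum_{h\in\mathcal H}\frac{\bar\pi_h}{n_h}\sum_{t\in\mathcal G_h}\beta^M_{h,t}(A_h).$$ Let $\nu\ge0$ be a bounded, almost everywhere continuous probability density on $(0,\infty)$ such that $\nu\log\frac1\nu$ and $\nu(x)\log(x+1)$ are integrable on $(0,\infty)$ and $\frac1\omega\sum_{k\ge1}\nu(k/\omega)\to\int_0^\infty\nu(x)\,dx=1$ as $\omega\to\infty$. For all large $\omega$ define the prior $$\bar\pi^{\omega,\nu}_h=\nu\Bigl(\frac{\log_2(1/h)}{\omega}\Bigr)\Big/\sum_{k=1}^\infty\nu\Bigl(\frac k\omega\Bigr),\qquad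 h\in\mathcal H,$$ write $\mathbf E_{\bar\pi^{\omega,\nu}}$ for the expectation over $h\sim\bar\pi^{\omega,\nu}$, and put $\log^*(\omega)=\log\log\omega$ and $$\widetilde R_h(q,\omega)=2[q+\log n_h+\log\omega]-\log\bigl[4\pi(q+\log n_h+\log\omega)\bigr].$$ Let $\mathbf A=\mathbf A^{\omega}=(A_h)_{h\in\mathcal H}$, $A_h\ge0$, be a family of amplitudes, which may depend on $\omega$. (i) If for some $x\in\mathbb R$ and $\epsilon>0$ $$\lim_{\omega\to\infty}\frac1{\log^*(\omega)}\mathbf E_{\bar\pi^{\omega,\nu}}\Bigl[\Bigl(\frac{A_h}{\sigma_h}-x\Bigr)^2+\epsilon\log^*(\omega)-\widetilde R_h(q_\alpha^\varkappa,\omega)\Bigr]_+=0,$$ then $\displaystyle\liminf_{\omega\to\infty}\bar\beta^M_{\bar\pi^{\omega,\nu}}(\mathbf A)\ge(1-\alpha)[1-\Phi(x)]$. (ii) If for some $\epsilon>0$ $$\lim_{\omega\to\infty}\frac1{\log^*(\omega)}\mathbf E_{\bar\pi^{\omega,\nu}}\Bigl[\widetilde R_h(q_\alpha^\varkappa,\omega)+2\sqrt{\epsilon\log^*(\omega)}\,\frac{A_h}{\sigma_h}-\frac{A_h^2}{\sigma_h^2}\Bigr]_+=0,$$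 then $\displaystyle\lim_{\omega\to\infty}\bar\beta^M_{\bar\pi^{\omega,\nu}}(\mathbf A)=0$. -/

import Mathlib

open Filter Topology MeasureTheory ProbabilityTheory

namespace MonoTest

noncomputable section

/-- The `k`-th dyadic bandwidth `h = 2^{-(k+1)}`, `k = 0, 1, 2, …`; the set of all bandwidths is
`{1/2, 1/4, 1/8, …}`, enumerated by `k`. -/
def bandwidth (k : ℕ) : ℝ := (1 / 2) ^ (k + 1)

/-- `n_h = 1 / (2h)`, the number of points of the grid `{h, 3h, …, 1 - h}`. -/
def gridSize (k : ℕ) : ℝ := 1 / (2 * bandwidth k)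

theorem gridSize_eq (k : ℕ) : gridSize k = 2 ^ k := by
  unfold gridSize bandwidth
  rw [pow_succ, one_div_pow]
  field_simp

/-- `log₂ (1 / h)` is the position of `h` in the list `1/2, 1/4, 1/8, …`. -/
theorem logb_bandwidth (k : ℕ) : Real.logb 2 (1 / bandwidth k) = (k : ℝ) + 1 := by
  unfold bandwidth
  rw [one_div_pow, one_div_one_div, Real.logb_pow, Real.logb_self_eq_one (by norm_num)]
  push_cast
  ring

/-- The pairs `(h, t)`: a bandwidth `h = 2^{-(k+1)}` and a point `t = (2j+1)h`, `0 ≤ j < n_h = 2^k`,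
of its grid `{h, 3h, …, 1 - h}`. -/
abbrev Cell : Type := Σ k : ℕ, Fin (2 ^ k)

/-- `σ_h = σ √(2 / h)`. -/
def noiseLevel (σ : ℝ) (k : ℕ) : ℝ := σ * √(2 / bandwidth k)

/-- The law of a family of independent standard Gaussian variables `ξ_{h,t}`. -/
def noiseLaw : Measure (Cell → ℝ) := Measure.infinitePi fun _ => gaussianReal 0 1

/-- `P_Θ`: the law of the observations `Y_{h,t} = θ_{h,t} + σ_h ξ_{h,t}`. -/
def obsLaw (σ : ℝ) (θ : Cell → ℝ) : Measure (Cell → ℝ) :=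
  noiseLaw.map fun ξ i => θ i + noiseLevel σ i.1 * ξ i

/-- The standard Gaussian distribution function. -/
def Phi (x : ℝ) : ℝ := cdf (gaussianReal 0 1) x

/-- `S(x) = 1 / Φ(x) - 1`. -/
def S (x : ℝ) : ℝ := 1 / Phi x - 1

/-- `Z_h^M = max_t log (S(Y_{h,t} / σ_h) / n_h)`, a maximum over a finite nonempty grid. -/
def levelStat (σ : ℝ) (k : ℕ) (Y : Cell → ℝ) : ℝ :=
  ⨆ j : Fin (2 ^ k), Real.log (1 / gridSize k * S (Y ⟨k, j⟩ / noiseLevel σ k))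

/-- `sup_h (Z_h^M + log p_h)`, in the extended reals, with `log 0 = -∞`. -/
def mapStat (σ : ℝ) (p : ℕ → ℝ) (Y : Cell → ℝ) : EReal :=
  ⨆ k : ℕ, ((levelStat σ k Y : ℝ) : EReal) + ENNReal.log (ENNReal.ofReal (p k))

/-- `q_α = -log log (1 / (1 - α))`, the `α`-value of `log (1/ϰ)` for a standard exponential `ϰ`. -/
def critVal (α : ℝ) : ℝ := -Real.log (Real.log (1 / (1 - α)))

/-- `Θ_{ρ,τ}(a)`: all entries are nonnegative except for the one at `i = (ρ, τ)`, which is `-a`. -/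
def alternatives (i : Cell) (a : ℝ) : Set (Cell → ℝ) :=
  {θ | θ i = -a ∧ ∀ i', i' ≠ i → 0 ≤ θ i'}

/-- `β_{ρ,τ}(a)`: the supremum over `Θ_{ρ,τ}(a)` of the probability that the MAP multi-level test
with weights `p` does not reject. -/
def typeII (α σ : ℝ) (p : ℕ → ℝ) (i : Cell) (a : ℝ) : ℝ :=
  ⨆ θ : alternatives i a,
    (obsLaw σ (θ : Cell → ℝ)).real {Y | mapStat σ p Y ≤ ((critVal α : ℝ) : EReal)}

/-- `∑_h (p_h / n_h) ∑_t β_{h,t}(A_h)`: the averaged type II error. -/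
def avgTypeII (α σ : ℝ) (p A : ℕ → ℝ) : ℝ :=
  ∑' k : ℕ, p k / gridSize k * ∑ j : Fin (2 ^ k), typeII α σ p ⟨k, j⟩ (A k)

/-- The prior `p_h = ν(log₂(1/h) / ω) / ∑_{m ≥ 1} ν(m / ω)`. -/
def prior (ν : ℝ → ℝ) (ω : ℝ) (k : ℕ) : ℝ :=
  ν (Real.logb 2 (1 / bandwidth k) / ω) / ∑' m : ℕ, ν (((m : ℝ) + 1) / ω)

/-- `2 [q + log n_h + log ω] - log (4π (q + log n_h + log ω))`. -/
def critRatio (q ω : ℝ) (k : ℕ) : ℝ :=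
  2 * (q + Real.log (gridSize k) + Real.log ω)
    - Real.log (4 * Real.pi * (q + Real.log (gridSize k) + Real.log ω))

/-- `E_p [g]_+ ∈ [0, ∞]`, for nonnegative weights `p`. -/
def posPartMean (p g : ℕ → ℝ) : ENNReal :=
  ∑' k : ℕ, ENNReal.ofReal (p k * max (g k) 0)

end

end MonoTest

/-! Write `r = log (1 / (1 - α))`, so that `exp q_α = 1 / r`. Solving the acceptance condition for
`Φ` shows that the test accepts exactly when `Φ(Y_{h,t} / σ_h) ≥ u_h` in every cell, with `u_h = p_h
r / (p_h r + n_h)`. By independence the acceptance probability is a product over cells. Keeping only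
the factor of the signal cell bounds the type II error above (`typeII_le`). Conversely, if all other
means vanish, each other factor is at least `1 - u_h ≥ exp (-r p_h / n_h)`; since the weights `p_h /
n_h` add up to one, these factors together contribute at least `exp (-r) = 1 - α` (`le_typeII`).

It remains to study one Gaussian tail at each level. If `p_h` is of order `1 / ω`, then `u_h` is of
order `exp (-(q_α + log n_h + log ω))`, and the `y` with `Φ(-y) = u_h` has `y²` equal to the
critical quantity up to a bounded error. The terms in `ε log log ω` absorb constants: see
`eventually_le_cellAccept` and `eventually_cellAccept_le`. Levels violating the amplitude condition
are controlled by a Markov inequality. Boundedness of `ν` gives `p_h ≤ C / ω`, which is all that (i)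
needs. Part (ii) also needs a lower bound on `p_h`; it fails only where `ν` is below `(log
ω)^(-ε/8)`, and the prior mass of those levels vanishes by Fatou and the convergence of the Riemann
sums (`tendsto_prior_small`). -/

namespace MonoTest

noncomputable section

/-! ### The Gaussian distribution function and its tails -/

/-- The standard Gaussian measure on the line. -/
abbrev stdGauss : Measure ℝ := gaussianReal 0 1

instance stdGauss_noAtoms : NullSingletonClass stdGauss :=
  nullSingletonClass_gaussianReal one_ne_zero

theorem Phi_eq (x : ℝ) : Phi x = stdGauss.real (Set.Iic x) := cdf_eq_real _ _

theorem Phi_mono : Monotone Phi := monotone_cdf _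

theorem one_sub_Phi (x : ℝ) : 1 - Phi x = stdGauss.real (Set.Ici x) := by
  rw [Phi_eq, ← probReal_compl_eq_one_sub measurableSet_Iic, Set.compl_Iic]
  exact measureReal_congr Ioi_ae_eq_Ici

theorem Phi_neg (x : ℝ) : Phi (-x) = stdGauss.real (Set.Ici x) := by
  have h : stdGauss.map (fun x => -x) = stdGauss := by
    rw [gaussianReal_map_neg, neg_zero]
  rw [Phi_eq]
  conv_lhs => rw [← h]
  rw [map_measureReal_apply (by fun_prop) measurableSet_Iic]
  congr 1
  ext y
  simp

theorem stdGauss_pos_of_isOpen {s : Set ℝ} (hs : IsOpen s) (hne : s.Nonempty) :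
    0 < stdGauss.real s := by
  rw [measureReal_def, ENNReal.toReal_pos_iff]
  refine ⟨pos_iff_ne_zero.2 fun h => ?_, measure_lt_top _ _⟩
  exact (hs.measure_pos volume hne).ne' (gaussianReal_absolutelyContinuous' 0 one_ne_zero h)

theorem Phi_pos (x : ℝ) : 0 < Phi x := by
  rw [Phi_eq]
  exact (stdGauss_pos_of_isOpen isOpen_Iio ⟨x - 1, by simp⟩).trans_le
    (measureReal_mono Set.Iio_subset_Iic_self)

theorem Phi_lt_one (x : ℝ) : Phi x < 1 := by
  have h := (stdGauss_pos_of_isOpen (isOpen_Ioi (a := x)) ⟨x + 1, by simp⟩).trans_le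
    (measureReal_mono Set.Ioi_subset_Ici_self)
  rw [← one_sub_Phi] at h
  linarith

theorem Phi_strictMono : StrictMono Phi := by
  intro x y hxy
  have h := stdGauss_pos_of_isOpen isOpen_Ioo (Set.nonempty_Ioo.2 hxy)
  have h2 : stdGauss.real (Set.Iic x ∪ Set.Ioo x y) = _ :=
    measureReal_union (Set.disjoint_left.2 fun z hz hz' => not_lt.2 hz hz'.1) measurableSet_Ioo
  have h3 : stdGauss.real (Set.Iic x ∪ Set.Ioo x y) ≤ stdGauss.real (Set.Iic y) :=
    measureReal_mono (Set.union_subset (Set.Iic_subset_Iic.2 hxy.le) fun z hz => hz.2.le)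
  rw [Phi_eq, Phi_eq]
  linarith

theorem continuous_Phi : Continuous Phi := by
  refine continuous_iff_continuousAt.2 fun x => ?_
  refine (Phi_mono.continuousAt_iff_leftLim_eq_rightLim).2 ?_
  have h1 := (cdf stdGauss).rightLim_eq x
  have h2 := (cdf stdGauss).measure_singleton x
  rw [measure_cdf, measure_singleton] at h2
  have h3 := ENNReal.ofReal_eq_zero.1 h2.symm
  refine le_antisymm (Phi_mono.leftLim_le_rightLim le_rfl) ?_
  change Function.rightLim (cdf stdGauss) x ≤ Function.leftLim (cdf stdGauss) x
  rw [h1]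
  linarith

theorem exists_Phi_eq {u : ℝ} (h0 : 0 < u) (h1 : u < 1) : ∃ c, Phi c = u := by
  obtain ⟨a, ha⟩ := ((tendsto_cdf_atBot stdGauss).eventually (gt_mem_nhds h0)).exists
  obtain ⟨b, hb⟩ := ((tendsto_cdf_atTop stdGauss).eventually (lt_mem_nhds h1)).exists
  exact mem_range_of_exists_le_of_exists_ge continuous_Phi ⟨a, ha.le⟩ ⟨b, hb.le⟩

/-- `Φ(ξ)` is uniformly distributed, as `Φ` is continuous; only this inequality is needed. -/
theorem one_sub_le_measure_le_Phi {u : ℝ} (h0 : 0 ≤ u) (h1 : u < 1) :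
    1 - u ≤ stdGauss.real {x | u ≤ Phi x} := by
  rcases h0.eq_or_lt with rfl | h0
  · simp [(Phi_pos _).le]
  obtain ⟨c, rfl⟩ := exists_Phi_eq h0 h1
  rw [one_sub_Phi]
  exact measureReal_mono fun x hx => Phi_mono hx

/-- An upper bound of Mills type for the Gaussian tail. -/
theorem Phi_neg_le {y : ℝ} (hy : 0 < y) :
    Phi (-y) ≤ Real.exp (-y ^ 2 / 2) / (y * √(2 * Real.pi)) := by
  have hd : ∀ x ∈ Set.Ici y, HasDerivAt (fun x : ℝ => -Real.exp (-x ^ 2 / 2))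
      (x * Real.exp (-x ^ 2 / 2)) x := by
    intro x _
    have h := ((((hasDerivAt_id x).pow 2).neg.div_const 2).exp).neg
    refine h.congr_deriv ?_
    simp
    ring
  have hlim : Tendsto (fun x : ℝ => -Real.exp (-x ^ 2 / 2)) atTop (𝓝 (-0)) := by
    refine (Real.tendsto_exp_atBot.comp ?_).neg
    refine Tendsto.atBot_div_const (by norm_num) ?_
    exact tendsto_neg_atTop_atBot.comp (tendsto_pow_atTop two_ne_zero)
  have hpos : ∀ x ∈ Set.Ioi y, 0 ≤ x * Real.exp (-x ^ 2 / 2) := fun x hx =>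
    mul_nonneg (hy.trans hx).le (Real.exp_pos _).le
  have hI := integral_Ioi_of_hasDerivAt_of_nonneg' hd hpos hlim
  have hInt := integrableOn_Ioi_deriv_of_nonneg' hd hpos hlim
  have hc : 0 < √(2 * Real.pi) := by positivity
  rw [Phi_neg, measureReal_def, gaussianReal_apply_eq_integral 0 one_ne_zero,
    ENNReal.toReal_ofReal (integral_nonneg fun x => gaussianPDFReal_nonneg _ _ _),
    integral_Ici_eq_integral_Ioi]
  calc ∫ x in Set.Ioi y, gaussianPDFReal 0 1 x
      -- On the tail `1 ≤ x / y`, and `x exp (-x² / 2)` has an elementary primitive.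
      ≤ ∫ x in Set.Ioi y, (1 / (y * √(2 * Real.pi))) * (x * Real.exp (-x ^ 2 / 2)) := by
        refine setIntegral_mono_on (integrable_gaussianPDFReal 0 1).integrableOn
          (hInt.const_mul _) measurableSet_Ioi fun x hx => ?_
        have hx' : y ≤ x := (Set.mem_Ioi.1 hx).le
        simp only [gaussianPDFReal, NNReal.coe_one, mul_one, sub_zero]
        rw [← mul_assoc]
        refine mul_le_mul_of_nonneg_right ?_ (Real.exp_pos _).le
        rw [one_div_mul_eq_div, inv_eq_one_div, div_le_div_iff₀ hc (by positivity), one_mul]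
        exact mul_le_mul_of_nonneg_right hx' hc.le
    _ = _ := by
        rw [integral_const_mul, hI]
        ring

/-- A lower bound for the Gaussian tail, sharp up to a constant factor. -/
theorem le_Phi_neg {y : ℝ} (hy : 0 ≤ y) :
    Real.exp (-3 / 2) / √(2 * Real.pi) * (Real.exp (-y ^ 2 / 2) / (1 + y)) ≤ Phi (-y) := by
  have hc : 0 < √(2 * Real.pi) := by positivity
  rw [Phi_neg]
  -- On an interval of length `1 / (1 + y)` the exponent `x² / 2` grows by at most `3 / 2`, so the
  -- density stays comparable to its value at `y`.
  set z := y + 1 / (1 + y) with hz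
  have hyz : 0 < 1 / (1 + y) := by positivity
  refine le_trans ?_ (measureReal_mono fun x (hx : x ∈ Set.Icc y z) => hx.1)
  rw [measureReal_def, gaussianReal_apply_eq_integral 0 one_ne_zero,
    ENNReal.toReal_ofReal (integral_nonneg fun x => gaussianPDFReal_nonneg _ _ _)]
  have hz2 : z ^ 2 ≤ y ^ 2 + 3 := by
    have h1 : 1 / (1 + y) ≤ 1 := by rw [div_le_one (by positivity)]; linarith
    have h2 : y * (1 / (1 + y)) ≤ 1 := by
      rw [mul_one_div, div_le_one (by positivity)]; linarith
    rw [hz]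
    nlinarith
  have hmono : ∫ _ in Set.Icc y z, Real.exp (-3 / 2) / √(2 * Real.pi) * Real.exp (-y ^ 2 / 2)
      ≤ ∫ x in Set.Icc y z, gaussianPDFReal 0 1 x := by
    refine setIntegral_mono_on continuousOn_const.integrableOn_Icc
      (integrable_gaussianPDFReal 0 1).integrableOn measurableSet_Icc fun x hx => ?_
    simp only [gaussianPDFReal, NNReal.coe_one, mul_one, sub_zero]
    rw [div_mul_eq_mul_div, ← Real.exp_add, div_eq_inv_mul]
    refine mul_le_mul_of_nonneg_left (Real.exp_le_exp.2 ?_) (by positivity)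
    have : x ^ 2 ≤ z ^ 2 := pow_le_pow_left₀ (hy.trans hx.1) hx.2 2
    linarith
  refine le_trans (le_of_eq ?_) hmono
  rw [setIntegral_const, Real.volume_real_Icc_of_le (by linarith), smul_eq_mul, hz]
  ring

theorem tendsto_Phi_neg {ι : Type*} {l : Filter ι} {f : ι → ℝ} (hf : Tendsto f l atTop) :
    Tendsto (fun i => Phi (-f i)) l (𝓝 0) :=
  (tendsto_cdf_atBot stdGauss).comp (tendsto_neg_atTop_atBot.comp hf)

/-! ### The acceptance region and the product formula for the type II error -/

theorem gridSize_pos (k : ℕ) : 0 < gridSize k := by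
  rw [gridSize_eq]
  positivity

theorem noiseLevel_pos {σ : ℝ} (hσ : 0 < σ) (k : ℕ) : 0 < noiseLevel σ k := by
  have : 0 < bandwidth k := by unfold bandwidth; positivity
  unfold noiseLevel
  positivity

/-- The level `log (1 / (1 - α)) = exp (-q_α)`. -/
def critRate (α : ℝ) : ℝ := Real.log (1 / (1 - α))

theorem critRate_pos {α : ℝ} (h0 : 0 < α) (h1 : α < 1) : 0 < critRate α :=
  Real.log_pos ((one_lt_div (by linarith)).2 (by linarith))

theorem exp_critVal {α : ℝ} (h0 : 0 < α) (h1 : α < 1) :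
    Real.exp (critVal α) = (critRate α)⁻¹ := by
  rw [critVal, Real.exp_neg]
  exact congrArg _ (Real.exp_log (critRate_pos h0 h1))

theorem exp_neg_critRate {α : ℝ} (h1 : α < 1) : Real.exp (-critRate α) = 1 - α := by
  rw [critRate, one_div, Real.log_inv, neg_neg, Real.exp_log (by linarith)]

/-- The MAP test accepts when `Φ(Y_{h,t} / σ_h)` is at least this number in every cell. -/
def acceptLevel (α : ℝ) (p : ℕ → ℝ) (k : ℕ) : ℝ :=
  p k * critRate α / (p k * critRate α + gridSize k)

section Accept

variable {α : ℝ} {p : ℕ → ℝ}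

theorem acceptLevel_nonneg (h0 : 0 < α) (h1 : α < 1) (hp : ∀ k, 0 ≤ p k) (k : ℕ) :
    0 ≤ acceptLevel α p k := by
  have := critRate_pos h0 h1
  have := gridSize_pos k
  have := hp k
  unfold acceptLevel
  positivity

theorem one_sub_acceptLevel (h0 : 0 < α) (h1 : α < 1) (hp : ∀ k, 0 ≤ p k) (k : ℕ) :
    1 - acceptLevel α p k = 1 / (1 + p k * critRate α / gridSize k) := by
  have := critRate_pos h0 h1
  have := gridSize_pos k
  have := hp k
  have : 0 < p k * critRate α + gridSize k := by positivity
  unfold acceptLevel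
  field_simp
  ring

theorem acceptLevel_lt_one (h0 : 0 < α) (h1 : α < 1) (hp : ∀ k, 0 ≤ p k) (k : ℕ) :
    acceptLevel α p k < 1 := by
  have := critRate_pos h0 h1
  have := gridSize_pos k
  have := hp k
  have h : 0 < 1 - acceptLevel α p k := by
    rw [one_sub_acceptLevel h0 h1 hp]
    positivity
  linarith

theorem cell_accept_iff (h0 : 0 < α) (h1 : α < 1) {k : ℕ} (hp : 0 < p k) (z : ℝ) :
    Real.log (1 / gridSize k * S z) + Real.log (p k) ≤ critVal α ↔
      acceptLevel α p k ≤ Phi z := by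
  have hr := critRate_pos h0 h1
  have hg := gridSize_pos k
  have hz := Phi_pos z
  have hS : 0 < S z := by
    unfold S
    rw [sub_pos, one_lt_div hz]
    exact Phi_lt_one z
  rw [← Real.log_mul (by positivity) hp.ne', Real.log_le_iff_le_exp (by positivity),
    exp_critVal h0 h1, acceptLevel, div_le_iff₀ (by positivity), ← one_div,
    le_div_iff₀ hr, S]
  rw [show 1 / gridSize k * (1 / Phi z - 1) * p k * critRate α
    = (p k * critRate α * (1 - Phi z)) / (gridSize k * Phi z) by field_simp,
    div_le_one (by positivity)]
  constructor <;> intro h <;> linarith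

theorem mapStat_le_iff {σ : ℝ} (h0 : 0 < α) (h1 : α < 1) (hp : ∀ k, 0 ≤ p k) (Y : Cell → ℝ) :
    mapStat σ p Y ≤ ((critVal α : ℝ) : EReal) ↔
      ∀ i : Cell, acceptLevel α p i.1 ≤ Phi (Y i / noiseLevel σ i.1) := by
  have key : ∀ k, ((levelStat σ k Y : ℝ) : EReal) + ENNReal.log (ENNReal.ofReal (p k))
      ≤ ((critVal α : ℝ) : EReal) ↔
      ∀ j, acceptLevel α p k ≤ Phi (Y ⟨k, j⟩ / noiseLevel σ k) := by
    intro k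
    -- A level of weight zero imposes no condition on either side: `log 0 = -∞` and the acceptance
    -- level is `0`.
    rcases (hp k).eq_or_lt with hk | hk
    · have : acceptLevel α p k = 0 := by simp [acceptLevel, ← hk]
      simp [← hk, this, (Phi_pos _).le]
    · have : Nonempty (Fin (2 ^ k)) := ⟨⟨0, by positivity⟩⟩
      rw [ENNReal.log_ofReal_of_pos hk, ← EReal.coe_add, EReal.coe_le_coe_iff,
        ← le_sub_iff_add_le, levelStat, ciSup_le_iff (Set.finite_range _).bddAbove]
      refine forall_congr' fun j => ?_
      rw [le_sub_iff_add_le, cell_accept_iff h0 h1 hk]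
  rw [mapStat, iSup_le_iff]
  simp only [key]
  exact ⟨fun h i => h i.1 i.2, fun h k j => h ⟨k, j⟩⟩

/-- The probability that a single cell with standardized amplitude `b` is accepted. -/
def cellAccept (α : ℝ) (p : ℕ → ℝ) (k : ℕ) (b : ℝ) : ℝ :=
  stdGauss.real {x | acceptLevel α p k ≤ Phi (x + b)}

theorem cellAccept_nonneg (k : ℕ) (b : ℝ) : 0 ≤ cellAccept α p k b := measureReal_nonneg

theorem measurableSet_accept (u b : ℝ) : MeasurableSet {x : ℝ | u ≤ Phi (x + b)} :=
  measurableSet_le measurable_const (Phi_mono.measurable.comp (by fun_prop))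

theorem measurable_obs (σ : ℝ) (θ : Cell → ℝ) :
    Measurable fun (ξ : Cell → ℝ) i => θ i + noiseLevel σ i.1 * ξ i := by
  fun_prop

instance : IsProbabilityMeasure noiseLaw := by
  unfold noiseLaw
  infer_instance

instance (σ : ℝ) (θ : Cell → ℝ) : IsProbabilityMeasure (obsLaw σ θ) :=
  Measure.isProbabilityMeasure_map (measurable_obs σ θ).aemeasurable

theorem obs_preimage {σ : ℝ} (h0 : 0 < α) (h1 : α < 1) (hσ : 0 < σ) (hp : ∀ k, 0 ≤ p k)
    (θ : Cell → ℝ) :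
    (fun (ξ : Cell → ℝ) i => θ i + noiseLevel σ i.1 * ξ i) ⁻¹'
      {Y | mapStat σ p Y ≤ ((critVal α : ℝ) : EReal)} =
    Set.univ.pi fun i : Cell =>
      {x | acceptLevel α p i.1 ≤ Phi (x + θ i / noiseLevel σ i.1)} := by
  ext ξ
  simp only [Set.mem_preimage, Set.mem_ofPred_eq, mapStat_le_iff h0 h1 hp, Set.mem_pi,
    Set.mem_univ, true_imp_iff]
  refine forall_congr' fun i => ?_
  have := (noiseLevel_pos hσ i.1).ne'
  rw [add_div, mul_div_cancel_left₀ _ this, add_comm]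

theorem measurableSet_acceptEvent {σ : ℝ} (h0 : 0 < α) (h1 : α < 1) (hp : ∀ k, 0 ≤ p k) :
    MeasurableSet {Y | mapStat σ p Y ≤ ((critVal α : ℝ) : EReal)} := by
  simp only [mapStat_le_iff h0 h1 hp, Set.ofPred_forall]
  exact MeasurableSet.iInter fun i =>
    measurableSet_le measurable_const (Phi_mono.measurable.comp (by fun_prop))

/-- Acceptance is a box in the independent noise variables. All factors are at most one, so the
infinite product is the infimum of its finite subproducts. -/
theorem obsLaw_accept {σ : ℝ} (h0 : 0 < α) (h1 : α < 1) (hσ : 0 < σ) (hp : ∀ k, 0 ≤ p k)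
    (θ : Cell → ℝ) :
    obsLaw σ θ {Y | mapStat σ p Y ≤ ((critVal α : ℝ) : EReal)} =
      ⨅ s : Finset Cell, ∏ i ∈ s,
        ENNReal.ofReal (cellAccept α p i.1 (θ i / noiseLevel σ i.1)) := by
  rw [obsLaw, Measure.map_apply (measurable_obs σ θ) (measurableSet_acceptEvent h0 h1 hp),
    obs_preimage h0 h1 hσ hp, noiseLaw,
    Measure.infinitePi_pi_univ _ fun i => measurableSet_accept _ _,
    ENNReal.tprod_eq_iInf_prod fun i => prob_le_one]
  simp [cellAccept]

theorem typeII_le {σ : ℝ} (h0 : 0 < α) (h1 : α < 1) (hσ : 0 < σ) (hp : ∀ k, 0 ≤ p k)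
    (i : Cell) (a : ℝ) :
    typeII α σ p i a ≤ cellAccept α p i.1 (-a / noiseLevel σ i.1) := by
  have : Nonempty (alternatives i a) :=
    ⟨⟨fun i' => open Classical in if i' = i then -a else 0, by simp,
      fun i' hi' => by simp [hi']⟩⟩
  refine ciSup_le fun θ => ?_
  rw [measureReal_def, obsLaw_accept h0 h1 hσ hp]
  refine ENNReal.toReal_le_of_le_ofReal measureReal_nonneg ((iInf_le _ {i}).trans ?_)
  rw [Finset.prod_singleton, θ.2.1]

theorem typeII_nonneg (σ : ℝ) (i : Cell) (a : ℝ) : 0 ≤ typeII α σ p i a :=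
  Real.iSup_nonneg fun _ => measureReal_nonneg

theorem typeII_le_one (σ : ℝ) (i : Cell) (a : ℝ) : typeII α σ p i a ≤ 1 :=
  Real.iSup_le (fun _ => measureReal_le_one) zero_le_one

/-- This is `1 / (1 + s) ≥ exp (-s)`; the exponential form makes the product over cells a sum of
weights. -/
theorem exp_neg_le_cellAccept_zero (h0 : 0 < α) (h1 : α < 1) (hp : ∀ k, 0 ≤ p k) (k : ℕ) :
    Real.exp (-(critRate α * (p k / gridSize k))) ≤ cellAccept α p k 0 := by
  have h := one_sub_le_measure_le_Phi (acceptLevel_nonneg h0 h1 hp k)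
    (acceptLevel_lt_one h0 h1 hp k)
  simp only [cellAccept, add_zero]
  refine le_trans ?_ h
  have := critRate_pos h0 h1
  have := gridSize_pos k
  have := hp k
  rw [one_sub_acceptLevel h0 h1 hp, Real.exp_neg, ← one_div]
  refine one_div_le_one_div_of_le (by positivity) ?_
  have := Real.add_one_le_exp (critRate α * (p k / gridSize k))
  calc _ = critRate α * (p k / gridSize k) + 1 := by ring
    _ ≤ _ := this

theorem sum_cell_le_one (hp : ∀ k, 0 ≤ p k) (hs : HasSum p 1) (s : Finset Cell) :
    ∑ i ∈ s, p i.1 / gridSize i.1 ≤ 1 := by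
  have h : HasSum (fun i : Cell => p i.1 / gridSize i.1) 1 := by
    refine HasSum.sigma_of_hasSum hs (fun k => ?_) ?_
    · have := hasSum_fintype fun _ : Fin (2 ^ k) => p k / gridSize k
      simp only [Finset.sum_const, Finset.card_univ, Fintype.card_fin, nsmul_eq_mul] at this
      convert this using 1
      have := (gridSize_pos k).ne'
      rw [gridSize_eq] at *
      push_cast
      field_simp
    · refine (summable_sigma_of_nonneg fun i => div_nonneg (hp _) (gridSize_pos _).le).2
        ⟨fun k => Summable.of_finite, ?_⟩
      refine hs.summable.congr fun k => ?_
      have := (gridSize_pos k).ne'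
      simp only [tsum_fintype, Finset.sum_const, Finset.card_univ, Fintype.card_fin,
        nsmul_eq_mul]
      rw [gridSize_eq] at *
      push_cast
      field_simp
  exact sum_le_hasSum s (fun i _ => div_nonneg (hp _) (gridSize_pos _).le) h

/-- Take the alternative whose other means are all zero: there the remaining factors have product at
least `exp (-r) = 1 - α`. -/
theorem le_typeII {σ : ℝ} (h0 : 0 < α) (h1 : α < 1) (hσ : 0 < σ) (hp : ∀ k, 0 ≤ p k)
    (hs : HasSum p 1) (i : Cell) (a : ℝ) :
    (1 - α) * cellAccept α p i.1 (-a / noiseLevel σ i.1) ≤ typeII α σ p i a := by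
  classical
  let θ : alternatives i a := ⟨fun i' => if i' = i then -a else 0, by simp,
      fun i' hi' => by simp [hi']⟩
  have hb : BddAbove (Set.range fun θ : alternatives i a => (obsLaw σ (θ : Cell → ℝ)).real
      {Y | mapStat σ p Y ≤ ((critVal α : ℝ) : EReal)}) :=
    ⟨1, by rintro _ ⟨θ, rfl⟩; exact measureReal_le_one⟩
  refine le_trans ?_ (le_ciSup hb θ)
  rw [measureReal_def, ← ENNReal.ofReal_le_iff_le_toReal (measure_ne_top _ _),
    obsLaw_accept h0 h1 hσ hp]
  refine le_iInf fun s => ?_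
  have hle : ∀ i', cellAccept α p i'.1 ((θ : Cell → ℝ) i' / noiseLevel σ i'.1) ≤ 1 :=
    fun i' => measureReal_le_one
  -- Adjoining the signal cell to `s` only decreases the product, so that cell may be assumed
  -- present.
  refine le_trans ?_ (Finset.prod_le_prod_of_subset_of_le_one' (Finset.subset_insert i s)
    fun i' _ _ => ENNReal.ofReal_le_one.2 (hle i'))
  rw [← ENNReal.ofReal_prod_of_nonneg fun i _ => cellAccept_nonneg i.1 _]
  refine ENNReal.ofReal_le_ofReal ?_
  rw [← Finset.mul_prod_erase _ _ (Finset.mem_insert_self i s), mul_comm]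
  simp only [θ, if_true]
  refine mul_le_mul_of_nonneg_left ?_ measureReal_nonneg
  rw [← exp_neg_critRate h1]
  calc Real.exp (-critRate α)
      ≤ Real.exp (∑ i' ∈ (insert i s).erase i, -(critRate α * (p i'.1 / gridSize i'.1))) := by
        rw [Real.exp_le_exp, Finset.sum_neg_distrib, ← Finset.mul_sum, neg_le_neg_iff]
        exact mul_le_of_le_one_right (critRate_pos h0 h1).le (sum_cell_le_one hp hs _)
    _ ≤ _ := by
        rw [Real.exp_sum]
        refine Finset.prod_le_prod (fun _ _ => (Real.exp_pos _).le) fun i' hi' => ?_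
        rw [if_neg (Finset.ne_of_mem_erase hi'), zero_div]
        exact exp_neg_le_cellAccept_zero h0 h1 hp _

theorem cellAccept_ge {k : ℕ} {a x y : ℝ} (h : acceptLevel α p k ≤ Phi (-y)) (hy : a - x ≤ y) :
    1 - Phi x ≤ cellAccept α p k (-a) := by
  rw [one_sub_Phi, cellAccept]
  refine measureReal_mono fun z hz => h.trans (Phi_mono ?_)
  have : x ≤ z := hz
  linarith

theorem cellAccept_le {k : ℕ} {a b y : ℝ} (h : Phi (-y) ≤ acceptLevel α p k) (hy : y + b ≤ a) :
    cellAccept α p k (-a) ≤ Phi (-b) := by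
  rw [Phi_neg, cellAccept]
  refine measureReal_mono fun z hz => ?_
  have := Phi_strictMono.le_iff_le.1 (h.trans hz)
  rw [Set.mem_Ici]
  linarith

end Accept

/-! ### Tails and acceptance near the critical amplitude -/

/-- The logarithmic correction turns `exp (-y² / 2)` into at least `exp (K - r) √(4πr)`, and the
root cancels the factor `1 + y` of the tail bound. Lowering `y²` by `2K` gains `exp K`. -/
theorem le_Phi_neg_of_sq_le {r y K : ℝ} (hr : 1 ≤ r) (hy : 0 ≤ y) (hK : 0 ≤ K)
    (h : y ^ 2 ≤ 2 * r - Real.log (4 * Real.pi * r) - 2 * K) :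
    Real.exp (-3 / 2) / √(2 * Real.pi) * (Real.exp K * Real.exp (-r)) ≤ Phi (-y) := by
  refine le_trans (mul_le_mul_of_nonneg_left ?_ (by positivity)) (le_Phi_neg hy)
  have hpi := Real.pi_gt_three
  have hlog : 0 ≤ Real.log (4 * Real.pi * r) := Real.log_nonneg (by nlinarith)
  have hy1 : 1 + y ≤ √(4 * Real.pi * r) := by
    refine Real.le_sqrt_of_sq_le ?_
    nlinarith [sq_nonneg (y - 1)]
  have hexp : √(4 * Real.pi * r) = Real.exp (Real.log (4 * Real.pi * r) / 2) := by
    rw [Real.exp_half, Real.exp_log (by positivity)]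
  rw [le_div_iff₀ (by positivity)]
  refine (mul_le_mul_of_nonneg_left hy1 (by positivity)).trans ?_
  rw [hexp, ← Real.exp_add, ← Real.exp_add, Real.exp_le_exp]
  linarith

/-- The matching upper bound: raising the squared amplitude by `2K` gains `exp (-K)`. The condition
on the logarithm makes the radicand at least `r`, so the Mills denominator dominates `√(4πr)` up to
a constant. -/
theorem Phi_neg_sqrt_le {r K : ℝ} (hr : 1 ≤ r) (hK : 0 ≤ K) (hlog : Real.log (4 * Real.pi * r) ≤ r) :
    Phi (-√(2 * r - Real.log (4 * Real.pi * r) + 2 * K)) ≤ 2 * Real.exp (-r - K) := by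
  set v := 2 * r - Real.log (4 * Real.pi * r) + 2 * K with hv
  have hpi := Real.pi_pos
  have hrv : r ≤ v := by linarith
  have hv0 : 0 < v := by linarith
  have hsq : √v ^ 2 = v := Real.sq_sqrt (by linarith)
  refine (Phi_neg_le (Real.sqrt_pos.2 (by linarith))).trans ?_
  rw [hsq, ← Real.sqrt_mul (by linarith), div_le_iff₀ (by positivity)]
  have hexp : √(4 * Real.pi * r) = Real.exp (Real.log (4 * Real.pi * r) / 2) := by
    rw [Real.exp_half, Real.exp_log (by positivity)]
  have h1 : Real.exp (-v / 2) = Real.exp (-r - K) * √(4 * Real.pi * r) := by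
    rw [hexp, ← Real.exp_add]
    congr 1
    rw [hv]
    ring
  rw [h1, mul_comm 2 (Real.exp _), mul_assoc (Real.exp _)]
  refine mul_le_mul_of_nonneg_left ?_ (Real.exp_pos _).le
  rw [Real.sqrt_le_left (by positivity), mul_pow, Real.sq_sqrt (by positivity)]
  nlinarith

theorem tendsto_log_log : Tendsto (fun ω : ℝ => Real.log (Real.log ω)) atTop atTop :=
  Real.tendsto_log_atTop.comp Real.tendsto_log_atTop

theorem eventually_log_le {c : ℝ} (hc : 0 < c) : ∀ᶠ r : ℝ in atTop, Real.log (c * r) ≤ r := by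
  have h := (Real.isLittleO_log_id_atTop.comp_tendsto
    (tendsto_id.const_mul_atTop hc)).bound (inv_pos.2 hc)
  filter_upwards [h, eventually_ge_atTop 0] with r hr h0
  simp only [Function.comp, id, Real.norm_eq_abs, abs_mul, abs_of_pos hc, abs_of_nonneg h0] at hr
  rw [inv_mul_cancel_left₀ hc.ne'] at hr
  exact (le_abs_self _).trans hr

section Level

variable {α : ℝ}

/-- The leading term `q_α + log n_h + log ω` of half the squared critical amplitude. -/
def leadingTerm (α ω : ℝ) (k : ℕ) : ℝ := critVal α + Real.log (gridSize k) + Real.log ω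

theorem critRatio_eq (ω : ℝ) (k : ℕ) : critRatio (critVal α) ω k =
    2 * leadingTerm α ω k - Real.log (4 * Real.pi * leadingTerm α ω k) := rfl

theorem one_le_gridSize (k : ℕ) : 1 ≤ gridSize k := by
  rw [gridSize_eq]
  exact one_le_pow₀ one_le_two

theorem le_leadingTerm (ω : ℝ) (k : ℕ) : critVal α + Real.log ω ≤ leadingTerm α ω k := by
  have := Real.log_nonneg (one_le_gridSize k)
  unfold leadingTerm
  linarith

theorem exp_neg_leadingTerm (h0 : 0 < α) (h1 : α < 1) {ω : ℝ} (hω : 0 < ω) (k : ℕ) :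
    Real.exp (-leadingTerm α ω k) = critRate α / (gridSize k * ω) := by
  have := (critRate_pos h0 h1).ne'
  rw [Real.exp_neg, leadingTerm, Real.exp_add, Real.exp_add, exp_critVal h0 h1,
    Real.exp_log (gridSize_pos k), Real.exp_log hω]
  field_simp

/-- Since `n_h ≥ 1`, the leading term is at least `q_α + log ω` at every level, whence the
uniformity in `k`. -/
theorem eventually_leadingTerm {P : ℝ → Prop} (hP : ∀ᶠ r in atTop, P r) :
    ∀ᶠ ω in atTop, ∀ k, P (leadingTerm α ω k) := by
  obtain ⟨r₀, hr₀⟩ := eventually_atTop.1 hP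
  filter_upwards [Real.tendsto_log_atTop.eventually_ge_atTop (r₀ - critVal α)] with ω hω k
  exact hr₀ _ (by linarith [le_leadingTerm (α := α) ω k])

theorem acceptLevel_le (h0 : 0 < α) (h1 : α < 1) {p : ℕ → ℝ} (hp : ∀ k, 0 ≤ p k) {k : ℕ}
    {ω C : ℝ} (hω : 0 < ω) (hk : p k ≤ C / ω) :
    acceptLevel α p k ≤ C * Real.exp (-leadingTerm α ω k) := by
  have hr := critRate_pos h0 h1
  have hg := gridSize_pos k
  have hpk := hp k
  calc acceptLevel α p k ≤ p k * critRate α / gridSize k := by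
        unfold acceptLevel
        exact div_le_div_of_nonneg_left (by positivity) hg (by nlinarith)
    _ ≤ C / ω * critRate α / gridSize k := by gcongr
    _ = _ := by
        rw [exp_neg_leadingTerm h0 h1 hω]
        field_simp

theorem le_acceptLevel (h0 : 0 < α) (h1 : α < 1) {p : ℕ → ℝ} (hp : ∀ k, 0 ≤ p k) {k : ℕ}
    {ω C : ℝ} (hω : 0 < ω) (hk : C / ω ≤ p k) (hk1 : p k ≤ 1) :
    C * Real.exp (-leadingTerm α ω k) / (critRate α + 1) ≤ acceptLevel α p k := by
  have hr := critRate_pos h0 h1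
  have hg := gridSize_pos k
  have hg1 := one_le_gridSize k
  have hpk := hp k
  calc C * Real.exp (-leadingTerm α ω k) / (critRate α + 1)
      = C / ω * critRate α / (gridSize k * (critRate α + 1)) := by
        rw [exp_neg_leadingTerm h0 h1 hω]
        field_simp
    _ ≤ p k * critRate α / (gridSize k * (critRate α + 1)) := by gcongr
    _ ≤ p k * critRate α / (p k * critRate α + gridSize k) := by
        refine div_le_div_of_nonneg_left (by positivity) (by positivity) ?_
        nlinarith [mul_le_mul (hk1.trans hg1) le_rfl hr.le hg.le]

/-- Amplitudes below the critical level are accepted with the asymptotic probability. -/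
theorem eventually_le_cellAccept (h0 : 0 < α) (h1 : α < 1) (C x : ℝ) {ε : ℝ} (hε : 0 < ε) :
    ∀ᶠ ω : ℝ in atTop, ∀ (p : ℕ → ℝ) (k : ℕ) (b : ℝ), (∀ k, 0 ≤ p k) → p k ≤ C / ω →
      (b - x) ^ 2 + ε * Real.log (Real.log ω) - critRatio (critVal α) ω k
        ≤ ε / 2 * Real.log (Real.log ω) →
      1 - Phi x ≤ cellAccept α p k (-b) := by
  set c := Real.exp (-3 / 2) / √(2 * Real.pi) with hc
  have hc0 : 0 < c := by positivity
  have hexp : ∀ᶠ ω : ℝ in atTop, C / c ≤ Real.exp (ε / 4 * Real.log (Real.log ω)) :=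
    (Real.tendsto_exp_atTop.comp
      (tendsto_log_log.const_mul_atTop (by positivity))).eventually_ge_atTop _
  filter_upwards [hexp, eventually_gt_atTop 0, tendsto_log_log.eventually_ge_atTop 0,
    eventually_leadingTerm (α := α) (eventually_ge_atTop 1)] with ω hCω hω hL hr p k b hp hpk hb
  -- The hypothesis says that `y²` is below the critical quantity by `2K` with `K = (ε / 4) log log
  -- ω`; then `exp K` absorbs the constant `C / c`.
  refine cellAccept_ge (y := |b - x|) ?_ (le_abs_self _)
  rw [critRatio_eq] at hb
  refine (acceptLevel_le h0 h1 hp hω hpk).trans (le_trans ?_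
    (le_Phi_neg_of_sq_le (K := ε / 4 * Real.log (Real.log ω)) (hr k) (abs_nonneg _)
      (by positivity) (by rw [sq_abs]; linarith)))
  rw [← mul_assoc]
  refine mul_le_mul_of_nonneg_right ?_ (Real.exp_pos _).le
  rwa [div_le_iff₀' hc0] at hCω

/-- Amplitudes above the critical level are accepted with negligible probability. -/
theorem eventually_cellAccept_le (h0 : 0 < α) (h1 : α < 1) {C ε : ℝ} (hC : 0 < C)
    (hε : 0 < ε) :
    ∀ᶠ ω : ℝ in atTop, ∀ (p : ℕ → ℝ) (k : ℕ) (b : ℝ), (∀ k, 0 ≤ p k) → p k ≤ 1 →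
      C * Real.exp (-(ε / 8 * Real.log (Real.log ω))) / ω ≤ p k → 0 ≤ b →
      critRatio (critVal α) ω k + 2 * √(ε * Real.log (Real.log ω)) * b - b ^ 2
        ≤ ε / 2 * Real.log (Real.log ω) →
      cellAccept α p k (-b) ≤ Phi (-√(ε * Real.log (Real.log ω))) := by
  have hr1 := critRate_pos h0 h1
  have hexp : ∀ᶠ ω : ℝ in atTop,
      2 * (critRate α + 1) / C ≤ Real.exp (ε / 8 * Real.log (Real.log ω)) :=
    (Real.tendsto_exp_atTop.comp
      (tendsto_log_log.const_mul_atTop (by positivity))).eventually_ge_atTop _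
  have hgap : ∀ᶠ ω : ℝ in atTop, Real.log ω / 2 ≤ critVal α + Real.log ω := by
    filter_upwards [Real.tendsto_log_atTop.eventually_ge_atTop (-2 * critVal α)] with ω hω
    linarith
  have hll : ∀ᶠ ω : ℝ in atTop, ε / 2 * Real.log (Real.log ω) < Real.log ω / 2 := by
    have h := (Real.isLittleO_log_id_atTop.comp_tendsto Real.tendsto_log_atTop).bound
      (c := (2 * ε)⁻¹) (by positivity)
    filter_upwards [h, Real.tendsto_log_atTop.eventually_gt_atTop 0] with ω hω hpos
    simp only [Function.comp, id, Real.norm_eq_abs, abs_of_pos hpos] at hω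
    have := mul_le_mul_of_nonneg_left ((le_abs_self _).trans hω) hε.le
    rw [mul_inv, ← mul_assoc, mul_comm 2⁻¹, mul_inv_cancel_left₀ hε.ne'] at this
    linarith
  filter_upwards [hexp, hgap, hll, eventually_gt_atTop 0, tendsto_log_log.eventually_ge_atTop 0,
    eventually_leadingTerm (α := α) (eventually_ge_atTop 1),
    eventually_leadingTerm (α := α) (eventually_log_le (c := 4 * Real.pi) (by positivity))]
    with ω hCω hgap hll hω hL hr hlog p k b hp hpk1 hpk hb hR
  set L := Real.log (Real.log ω) with hLdef
  have hlead := le_leadingTerm (α := α) ω k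
  rw [critRatio_eq] at hR
  have hs : √(ε * L) ^ 2 = ε * L := Real.sq_sqrt (by positivity)
  have hs0 := Real.sqrt_nonneg (ε * L)
  -- Completing the square in the hypothesis gives `(b - √(εL))² ≥ y²` for this `y`. Of the gain
  -- `exp (-εL / 4)`, half pays for the small prior weight and half for the constants.
  refine cellAccept_le (y := √(2 * leadingTerm α ω k - Real.log (4 * Real.pi * leadingTerm α ω k)
    + 2 * (ε / 4 * L))) ?_ ?_
  · refine (Phi_neg_sqrt_le (hr k) (by positivity) (hlog k)).trans
      (le_trans ?_ (le_acceptLevel h0 h1 hp hω hpk hpk1))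
    rw [le_div_iff₀ (by positivity)]
    rw [div_le_iff₀' hC] at hCω
    calc 2 * Real.exp (-leadingTerm α ω k - ε / 4 * L) * (critRate α + 1)
        = 2 * (critRate α + 1) * Real.exp (-leadingTerm α ω k - ε / 4 * L) := by ring
      _ ≤ C * Real.exp (ε / 8 * L) * Real.exp (-leadingTerm α ω k - ε / 4 * L) := by gcongr
      _ = _ := by
          rw [mul_assoc, mul_assoc, ← Real.exp_add, ← Real.exp_add]
          congr 2
          ring
  · have hlogk := hlog k
    -- This selects the correct root: for smaller `b` the critical quantity would be at most `εL /
    -- 2`, whereas it is at least `log ω / 2`.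
    have hsb : √(ε * L) ≤ b := by
      by_contra! hlt
      nlinarith
    rw [← le_sub_iff_add_le]
    refine Real.sqrt_le_iff.2 ⟨by linarith, ?_⟩
    nlinarith

end Level

/-! ### Mass estimates for the prior -/

section Prior

variable {ν : ℝ → ℝ}

theorem prior_eq (ν : ℝ → ℝ) (ω : ℝ) (k : ℕ) :
    prior ν ω k = ν (((k : ℝ) + 1) / ω) / ∑' m : ℕ, ν (((m : ℝ) + 1) / ω) := by
  rw [prior, logb_bandwidth]

/-- The total weight `∑ ν (m / ω)` is of order `ω`. -/
theorem eventually_tsum_bounds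
    (hν : Tendsto (fun ω : ℝ => 1 / ω * ∑' m : ℕ, ν (((m : ℝ) + 1) / ω)) atTop (𝓝 1)) :
    ∀ᶠ ω : ℝ in atTop, 0 < ω ∧ ω / 2 ≤ ∑' m : ℕ, ν (((m : ℝ) + 1) / ω) ∧
      ∑' m : ℕ, ν (((m : ℝ) + 1) / ω) ≤ 2 * ω := by
  filter_upwards [eventually_gt_atTop 0, hν.eventually (lt_mem_nhds (by norm_num : (1 / 2 : ℝ) < 1)),
    hν.eventually (gt_mem_nhds one_lt_two)] with ω hω h1 h2
  rw [one_div_mul_eq_div] at h1 h2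
  rw [lt_div_iff₀ hω] at h1
  rw [div_lt_iff₀ hω] at h2
  exact ⟨hω, by linarith, h2.le⟩

theorem hasSum_prior {ω : ℝ} (h : 0 < ∑' m : ℕ, ν (((m : ℝ) + 1) / ω)) :
    HasSum (prior ν ω) 1 := by
  have hs : Summable fun m : ℕ => ν (((m : ℝ) + 1) / ω) := by
    -- A divergent `tsum` is zero by default, contrary to positivity.
    by_contra hn
    exact h.ne' (tsum_eq_zero_of_not_summable hn)
  have := hs.hasSum.div_const (∑' m : ℕ, ν (((m : ℝ) + 1) / ω))
  rw [div_self h.ne'] at this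
  simpa only [← prior_eq] using this

theorem prior_nonneg (hν : ∀ x, 0 < x → 0 ≤ ν x) {ω : ℝ} (hω : 0 < ω) (k : ℕ) :
    0 ≤ prior ν ω k := by
  rw [prior_eq]
  exact div_nonneg (hν _ (by positivity)) (tsum_nonneg fun m => hν _ (by positivity))

/-- Riemann sums dominate integrals of step functions. -/
theorem lintegral_floor_le {ω : ℝ} (hω : 0 < ω) (f : ℕ → ENNReal) :
    ∫⁻ x in Set.Ioi (0 : ℝ), f ⌊x * ω⌋₊ ≤ ENNReal.ofReal (1 / ω) * ∑' k, f k := by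
  have hm : Measurable fun x : ℝ => ⌊x * ω⌋₊ := Nat.measurable_floor.comp (by fun_prop)
  rw [← lintegral_map (f := f) (measurable_of_countable f) hm, lintegral_countable',
    ← ENNReal.tsum_mul_left]
  refine ENNReal.tsum_le_tsum fun k => ?_
  rw [mul_comm]
  refine mul_le_mul_left ?_ _
  rw [Measure.map_apply hm (measurableSet_singleton k),
    Measure.restrict_apply (hm (measurableSet_singleton k))]
  have hsub : ((fun x : ℝ => ⌊x * ω⌋₊) ⁻¹' {k} ∩ Set.Ioi 0) ⊆
      Set.Icc ((k : ℝ) / ω) ((k + 1) / ω) := by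
    rintro x ⟨hx, hx0⟩
    have hx0' : 0 < x := hx0
    have h : ⌊x * ω⌋₊ = k := hx
    obtain ⟨ha, hb⟩ := (Nat.floor_eq_iff (by positivity)).1 h
    exact ⟨(div_le_iff₀ hω).2 ha, (le_div_iff₀ hω).2 hb.le⟩
  refine (measure_mono hsub).trans ?_
  rw [Real.volume_Icc]
  refine ENNReal.ofReal_le_ofReal (le_of_eq ?_)
  field_simp
  ring

/-- The prior mass of the levels where the density `ν` is smaller than `δ ω → 0` vanishes. -/
theorem tendsto_prior_small (hν_nonneg : ∀ x, 0 < x → 0 ≤ ν x)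
    (hν_cont : ∀ᵐ x ∂(volume.restrict (Set.Ioi (0 : ℝ))), ContinuousAt ν x)
    (hν_int : ∫ x in Set.Ioi (0 : ℝ), ν x = 1)
    (hν : Tendsto (fun ω : ℝ => 1 / ω * ∑' m : ℕ, ν (((m : ℝ) + 1) / ω)) atTop (𝓝 1))
    {δ : ℝ → ℝ} (hδ : Tendsto δ atTop (𝓝 0)) :
    Tendsto (fun ω => ∑' k : ℕ, ENNReal.ofReal
      (if ν (((k : ℝ) + 1) / ω) ≤ δ ω then prior ν ω k else 0)) atTop (𝓝 0) := by
  classical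
  set hi : ℝ → ℕ → ENNReal := fun ω k => ENNReal.ofReal
    (if ν (((k : ℝ) + 1) / ω) ≤ δ ω then 0 else ν (((k : ℝ) + 1) / ω)) with hhi
  set lo : ℝ → ℕ → ENNReal := fun ω k => ENNReal.ofReal
    (if ν (((k : ℝ) + 1) / ω) ≤ δ ω then ν (((k : ℝ) + 1) / ω) else 0) with hlo
  have hae0 : ∀ᵐ x ∂(volume.restrict (Set.Ioi (0 : ℝ))), 0 < x :=
    ae_restrict_mem measurableSet_Ioi
  have hint : Integrable ν (volume.restrict (Set.Ioi (0 : ℝ))) := by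
    by_contra h
    rw [integral_undef h] at hν_int
    exact zero_ne_one hν_int
  have hone : ∫⁻ x in Set.Ioi (0 : ℝ), ENNReal.ofReal (ν x) = 1 := by
    rw [← ofReal_integral_eq_lintegral_ofReal hint (hae0.mono fun x hx => hν_nonneg x hx),
      hν_int, ENNReal.ofReal_one]
  -- Where `ν x > 0` and `ν` is continuous, the truncation at `δ ω → 0` is eventually inactive, so
  -- the step functions converge to `ν x`; Fatou gives the bound.
  have hfatou : 1 ≤ liminf (fun ω : ℝ => ∫⁻ x in Set.Ioi (0 : ℝ), hi ω ⌊x * ω⌋₊) atTop := by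
    rw [← hone]
    refine le_trans (lintegral_mono_ae ?_) (lintegral_liminf_le fun ω =>
      (measurable_of_countable (hi ω)).comp (Nat.measurable_floor.comp (by fun_prop)))
    filter_upwards [hae0, hν_cont] with x hx hc
    rcases (hν_nonneg x hx).eq_or_lt with h | h
    · simp [← h]
    have hlim : Tendsto (fun ω : ℝ => ((⌊x * ω⌋₊ : ℝ) + 1) / ω) atTop (𝓝 x) := by
      simp only [add_div]
      simpa using (tendsto_nat_floor_mul_div_atTop hx.le).add
        (tendsto_inv_atTop_zero (𝕜 := ℝ))
    have hνlim := hc.tendsto.comp hlim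
    refine (Tendsto.liminf_eq ?_).ge
    refine (ENNReal.tendsto_ofReal hνlim).congr' ?_
    filter_upwards [(hδ.eventually (gt_mem_nhds (half_pos h))),
      hνlim.eventually (lt_mem_nhds (half_lt_self h))] with ω h1 h2
    have h3 : ¬ ν (((⌊x * ω⌋₊ : ℝ) + 1) / ω) ≤ δ ω := not_le.2 (h1.trans h2)
    simp only [hhi, if_neg h3, Function.comp]
  -- The full Riemann sum tends to `1` and its `hi` part has lower limit at least `1`, so nothing is
  -- left for `lo`.
  have hmass : Tendsto (fun ω => ENNReal.ofReal (1 / ω) * ∑' k, lo ω k) atTop (𝓝 0) := by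
    refine ENNReal.tendsto_nhds_zero.2 fun η hη => ?_
    rcases eq_or_ne η ⊤ with rfl | hηt
    · simp
    have hη2 : (η / 2) ≠ 0 := (ENNReal.half_pos hη.ne').ne'
    have hup : ∀ᶠ ω in atTop,
        ENNReal.ofReal (1 / ω * ∑' m : ℕ, ν (((m : ℝ) + 1) / ω)) < 1 + η / 2 := by
      refine (ENNReal.tendsto_ofReal hν).eventually (gt_mem_nhds ?_)
      rw [ENNReal.ofReal_one]
      exact ENNReal.lt_add_right ENNReal.one_ne_top hη2
    have hlow : ∀ᶠ ω in atTop, 1 - η / 2 < ∫⁻ x in Set.Ioi (0 : ℝ), hi ω ⌊x * ω⌋₊ :=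
      eventually_lt_of_lt_liminf (lt_of_lt_of_le
        (ENNReal.sub_lt_self ENNReal.one_ne_top one_ne_zero hη2) hfatou)
    filter_upwards [hup, hlow, eventually_tsum_bounds hν] with ω h1 h2 ⟨hω, hT, _⟩
    have hs := (hasSum_prior (ν := ν) (ω := ω) (by linarith)).summable
    have hsum : ENNReal.ofReal (1 / ω) * ∑' k, lo ω k + ENNReal.ofReal (1 / ω) * ∑' k, hi ω k
        = ENNReal.ofReal (1 / ω * ∑' m : ℕ, ν (((m : ℝ) + 1) / ω)) := by
      rw [← mul_add, ← ENNReal.tsum_add, ENNReal.ofReal_mul (by positivity),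
        ENNReal.ofReal_tsum_of_nonneg (fun k => hν_nonneg _ (by positivity))]
      · congr 1
        refine tsum_congr fun k => ?_
        simp only [hhi, hlo]
        split_ifs <;> simp
      · refine (hs.mul_right (∑' m : ℕ, ν (((m : ℝ) + 1) / ω))).congr fun k => ?_
        rw [prior_eq, div_mul_cancel₀ _ (by linarith)]
    have h3 := h2.trans_le (lintegral_floor_le hω (hi ω))
    have h4 : ENNReal.ofReal (1 / ω) * ∑' k, lo ω k + (1 - η / 2) ≤ 1 + η / 2 := by
      refine le_trans ?_ h1.le
      rw [← hsum]
      exact add_le_add_right h3.le _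
    have h5 : 1 + η / 2 ≤ η + (1 - η / 2) := by
      calc 1 + η / 2 ≤ (1 - η / 2 + η / 2) + η / 2 := add_le_add_left le_tsub_add _
        _ = η + (1 - η / 2) := by rw [add_assoc, ENNReal.add_halves, add_comm]
    exact (ENNReal.add_le_add_iff_right
      (ne_top_of_le_ne_top ENNReal.one_ne_top tsub_le_self)).1 (h4.trans h5)
  -- The factor `2` comes from normalizing by a total weight of at least `ω / 2`.
  have hmass2 : Tendsto (fun ω => 2 * (ENNReal.ofReal (1 / ω) * ∑' k, lo ω k)) atTop (𝓝 0) := by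
    simpa using ENNReal.Tendsto.const_mul hmass (Or.inr ENNReal.ofNat_ne_top)
  refine tendsto_of_tendsto_of_tendsto_of_le_of_le' tendsto_const_nhds hmass2
    (Eventually.of_forall fun _ => zero_le) ?_
  filter_upwards [eventually_tsum_bounds hν] with ω ⟨hω, hT, _⟩
  rw [← mul_assoc, ← ENNReal.tsum_mul_left]
  refine ENNReal.tsum_le_tsum fun k => ?_
  have h2 : (2 : ENNReal) = ENNReal.ofReal 2 := by simp
  simp only [hlo]
  rw [h2, ← ENNReal.ofReal_mul zero_le_two, ← ENNReal.ofReal_mul (by positivity)]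
  refine ENNReal.ofReal_le_ofReal ?_
  split_ifs
  · rw [prior_eq, div_eq_mul_inv, mul_comm]
    refine mul_le_mul_of_nonneg_right ?_ (hν_nonneg _ (by positivity))
    calc (∑' m : ℕ, ν (((m : ℝ) + 1) / ω))⁻¹ ≤ (ω / 2)⁻¹ := by gcongr
      _ = _ := by field_simp
  · simp

end Prior

/-! ### Averaging over levels -/

section Average

variable {α : ℝ} {p : ℕ → ℝ}

/-- The type II error averaged over the grid of one bandwidth. -/
def levelTypeII (α σ : ℝ) (p : ℕ → ℝ) (k : ℕ) (a : ℝ) : ℝ :=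
  (∑ j : Fin (2 ^ k), typeII α σ p ⟨k, j⟩ a) / gridSize k

theorem levelTypeII_le {σ a c : ℝ} {k : ℕ} (h : ∀ j, typeII α σ p ⟨k, j⟩ a ≤ c) :
    levelTypeII α σ p k a ≤ c := by
  rw [levelTypeII, div_le_iff₀ (gridSize_pos k)]
  refine (Finset.sum_le_sum fun j _ => h j).trans (le_of_eq ?_)
  simp [gridSize_eq, mul_comm]

theorem le_levelTypeII {σ a c : ℝ} {k : ℕ} (h : ∀ j, c ≤ typeII α σ p ⟨k, j⟩ a) :
    c ≤ levelTypeII α σ p k a := by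
  rw [levelTypeII, le_div_iff₀ (gridSize_pos k)]
  refine le_trans (le_of_eq ?_) (Finset.sum_le_sum fun j _ => h j)
  simp [gridSize_eq, mul_comm]

theorem avgTypeII_eq (σ : ℝ) (A : ℕ → ℝ) :
    avgTypeII α σ p A = ∑' k, p k * levelTypeII α σ p k (A k) :=
  tsum_congr fun k => by rw [levelTypeII]; ring

theorem avgTypeII_nonneg (hp : ∀ k, 0 ≤ p k) (σ : ℝ) (A : ℕ → ℝ) : 0 ≤ avgTypeII α σ p A := by
  rw [avgTypeII_eq]
  exact tsum_nonneg fun k => mul_nonneg (hp k) (le_levelTypeII fun j => typeII_nonneg _ _ _)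

theorem ofReal_avgTypeII (hp : ∀ k, 0 ≤ p k) (hs : Summable p) (σ : ℝ) (A : ℕ → ℝ) :
    ENNReal.ofReal (avgTypeII α σ p A) =
      ∑' k, ENNReal.ofReal (p k * levelTypeII α σ p k (A k)) := by
  rw [avgTypeII_eq]
  have h0 : ∀ k, 0 ≤ p k * levelTypeII α σ p k (A k) := fun k =>
    mul_nonneg (hp k) (le_levelTypeII fun j => typeII_nonneg _ _ _)
  refine ENNReal.ofReal_tsum_of_nonneg h0 (Summable.of_nonneg_of_le h0 (fun k => ?_) hs)
  exact mul_le_of_le_one_right (hp k) (levelTypeII_le fun j => typeII_le_one _ _ _)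

theorem avgTypeII_le_one (hp : ∀ k, 0 ≤ p k) (hs : HasSum p 1) (σ : ℝ) (A : ℕ → ℝ) :
    avgTypeII α σ p A ≤ 1 := by
  rw [← ENNReal.ofReal_le_one, ofReal_avgTypeII hp hs.summable, ← ENNReal.ofReal_one,
    ← hs.tsum_eq, ENNReal.ofReal_tsum_of_nonneg hp hs.summable]
  exact ENNReal.tsum_le_tsum fun k => ENNReal.ofReal_le_ofReal
    (mul_le_of_le_one_right (hp k) (levelTypeII_le fun j => typeII_le_one _ _ _))

theorem tsum_ofReal_mul_const (hp : ∀ k, 0 ≤ p k) (hs : HasSum p 1) {c : ℝ} (hc : 0 ≤ c) :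
    ∑' k, ENNReal.ofReal (p k * c) = ENNReal.ofReal c := by
  rw [← ENNReal.ofReal_tsum_of_nonneg (fun k => mul_nonneg (hp k) hc) (hs.summable.mul_right c),
    tsum_mul_right, hs.tsum_eq, one_mul]

theorem tsum_posPart_div (p g : ℕ → ℝ) {d : ℝ} (hd : 0 < d) :
    ∑' k, ENNReal.ofReal (p k * max (g k) 0 / d) = posPartMean p g / ENNReal.ofReal d := by
  simp only [ENNReal.ofReal_div_of_pos hd, ENNReal.div_eq_inv_mul, ENNReal.tsum_mul_left,
    posPartMean]

/-- Lower bound of Markov type: the levels with `g k ≤ d` have a large type II error. -/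
theorem le_avgTypeII (hp : ∀ k, 0 ≤ p k) (hs : HasSum p 1) {σ : ℝ} {A g : ℕ → ℝ} {c d : ℝ}
    (hc0 : 0 ≤ c) (hc1 : c ≤ 1) (hd : 0 < d)
    (h : ∀ k, g k ≤ d → c ≤ levelTypeII α σ p k (A k)) :
    ENNReal.ofReal c ≤
      ENNReal.ofReal (avgTypeII α σ p A) + posPartMean p g / ENNReal.ofReal d := by
  rw [← tsum_ofReal_mul_const hp hs hc0, ofReal_avgTypeII hp hs.summable,
    ← tsum_posPart_div p g hd, ← ENNReal.tsum_add]
  refine ENNReal.tsum_le_tsum fun k => ?_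
  have ht : 0 ≤ levelTypeII α σ p k (A k) := le_levelTypeII fun j => typeII_nonneg _ _ _
  have hpk := hp k
  rw [← ENNReal.ofReal_add (by positivity) (by positivity)]
  refine ENNReal.ofReal_le_ofReal ?_
  rw [mul_div_assoc, ← mul_add]
  refine mul_le_mul_of_nonneg_left ?_ hpk
  rcases le_or_gt (g k) d with hg | hg
  · exact (h k hg).trans (le_add_of_nonneg_right (by positivity))
  -- On an exceptional level the Markov term alone exceeds the bound, since `c ≤ 1`.
  · have : 1 ≤ max (g k) 0 / d := (one_le_div hd).2 (hg.le.trans (le_max_left _ _))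
    linarith

/-- Upper bound of Markov type: outside the set `B`, the levels with `g k ≤ d` have a small
type II error. -/
theorem avgTypeII_le (hp : ∀ k, 0 ≤ p k) (hs : HasSum p 1) {σ : ℝ} {A g : ℕ → ℝ} {c d : ℝ}
    (hc0 : 0 ≤ c) (hd : 0 < d) (B : ℕ → Prop) [DecidablePred B]
    (h : ∀ k, ¬ B k → g k ≤ d → levelTypeII α σ p k (A k) ≤ c) :
    ENNReal.ofReal (avgTypeII α σ p A) ≤
      ENNReal.ofReal c + posPartMean p g / ENNReal.ofReal d +
        ∑' k, ENNReal.ofReal (if B k then p k else 0) := by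
  rw [← tsum_ofReal_mul_const hp hs hc0, ofReal_avgTypeII hp hs.summable,
    ← tsum_posPart_div p g hd, ← ENNReal.tsum_add, ← ENNReal.tsum_add]
  refine ENNReal.tsum_le_tsum fun k => ?_
  have ht : levelTypeII α σ p k (A k) ≤ 1 := levelTypeII_le fun j => typeII_le_one _ _ _
  have hpk := hp k
  have hg0 : 0 ≤ max (g k) 0 / d := by positivity
  have hi0 : 0 ≤ if B k then p k else 0 := by split_ifs <;> simp [hpk]
  rw [← ENNReal.ofReal_add (by positivity) (by positivity),
    ← ENNReal.ofReal_add (by positivity) hi0]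
  refine ENNReal.ofReal_le_ofReal ?_
  rw [mul_div_assoc, ← mul_add]
  have hbound : ∀ t : ℝ, levelTypeII α σ p k (A k) ≤ t →
      p k * levelTypeII α σ p k (A k) ≤ p k * t := fun t ht' => mul_le_mul_of_nonneg_left ht' hpk
  by_cases hB : B k
  · rw [if_pos hB]
    have h1 : p k * levelTypeII α σ p k (A k) ≤ p k := mul_le_of_le_one_right hpk ht
    have h2 : 0 ≤ p k * (c + max (g k) 0 / d) := by positivity
    linarith
  · rw [if_neg hB, add_zero]
    refine hbound _ ?_
    rcases le_or_gt (g k) d with hg | hg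
    · exact (h k hB hg).trans (le_add_of_nonneg_right hg0)
    · have : 1 ≤ max (g k) 0 / d := (one_le_div hd).2 (hg.le.trans (le_max_left _ _))
      linarith

theorem tendsto_div_ofReal_const_mul {f : ℝ → ENNReal} {d : ℝ → ℝ} {c : ℝ} (hc : 0 < c)
    (h : Tendsto (fun ω => f ω / ENNReal.ofReal (d ω)) atTop (𝓝 0)) :
    Tendsto (fun ω => f ω / ENNReal.ofReal (c * d ω)) atTop (𝓝 0) := by
  have h' := ENNReal.Tendsto.const_mul (a := (ENNReal.ofReal c)⁻¹) h
    (Or.inr (ENNReal.inv_ne_top.2 (ENNReal.ofReal_pos.2 hc).ne'))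
  rw [mul_zero] at h'
  refine h'.congr fun ω => ?_
  rw [ENNReal.ofReal_mul hc.le, ENNReal.div_eq_inv_mul, ENNReal.div_eq_inv_mul,
    ENNReal.mul_inv (Or.inl (ENNReal.ofReal_pos.2 hc).ne') (Or.inl ENNReal.ofReal_ne_top),
    mul_assoc]

end Average

end

end MonoTest

/-! ### The two asymptotic statements -/

theorem mainTheorem8 (α σ : ℝ) (hα0 : 0 < α) (hα1 : α < 1) (hσ : 0 < σ)
    (ν : ℝ → ℝ)
    -- `ν` is a bounded, almost everywhere continuous probability density on `(0, ∞)`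
    (hν_nonneg : ∀ x, 0 < x → 0 ≤ ν x)
    (hν_bdd : ∃ M : ℝ, ∀ x, 0 < x → ν x ≤ M)
    (hν_cont : ∀ᵐ x ∂(volume.restrict (Set.Ioi (0 : ℝ))), ContinuousAt ν x)
    (hν_int : ∫ x in Set.Ioi (0 : ℝ), ν x = 1)
    -- with finite entropy and finite logarithmic moment
    (hν_entropy : IntegrableOn (fun x => ν x * Real.log (1 / ν x)) (Set.Ioi 0))
    (hν_log : IntegrableOn (fun x => ν x * Real.log (x + 1)) (Set.Ioi 0))
    -- whose Riemann sums over `(0, ∞)` converge to its integral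
    (hν_riemann : Tendsto (fun ω : ℝ => 1 / ω * ∑' m : ℕ, ν (((m : ℝ) + 1) / ω)) atTop (𝓝 1))
    -- the amplitudes `A_h ≥ 0`, which may vary with `ω`
    (A : ℝ → ℕ → ℝ) (hA : ∀ ω k, 0 ≤ A ω k) :
    (∀ x ε : ℝ, 0 < ε →
      Tendsto (fun ω : ℝ =>
          MonoTest.posPartMean (MonoTest.prior ν ω) (fun k =>
            (A ω k / MonoTest.noiseLevel σ k - x) ^ 2 + ε * Real.log (Real.log ω)
              - MonoTest.critRatio (MonoTest.critVal α) ω k)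
            / ENNReal.ofReal (Real.log (Real.log ω)))
        atTop (𝓝 0) →
      (1 - α) * (1 - MonoTest.Phi x) ≤
        liminf (fun ω : ℝ => MonoTest.avgTypeII α σ (MonoTest.prior ν ω) (A ω)) atTop) ∧
    (∀ ε : ℝ, 0 < ε →
      Tendsto (fun ω : ℝ =>
          MonoTest.posPartMean (MonoTest.prior ν ω) (fun k =>
            MonoTest.critRatio (MonoTest.critVal α) ω k
              + 2 * √(ε * Real.log (Real.log ω)) * (A ω k / MonoTest.noiseLevel σ k)
              - (A ω k) ^ 2 / (MonoTest.noiseLevel σ k) ^ 2)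
            / ENNReal.ofReal (Real.log (Real.log ω)))
        atTop (𝓝 0) →
      Tendsto (fun ω : ℝ => MonoTest.avgTypeII α σ (MonoTest.prior ν ω) (A ω)) atTop (𝓝 0)) := by
  obtain ⟨M, hM⟩ := hν_bdd
  have hM0 : 0 ≤ M := (hν_nonneg 1 one_pos).trans (hM 1 one_pos)
  have hprior : ∀ᶠ ω : ℝ in atTop, 0 < ω ∧ (∀ k, 0 ≤ MonoTest.prior ν ω k) ∧
      HasSum (MonoTest.prior ν ω) 1 ∧ (∀ k, MonoTest.prior ν ω k ≤ 2 * M / ω) ∧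
      ∀ k : ℕ, ν (((k : ℝ) + 1) / ω) / (2 * ω) ≤ MonoTest.prior ν ω k := by
    filter_upwards [MonoTest.eventually_tsum_bounds hν_riemann] with ω ⟨hω, hT1, hT2⟩
    have hT : 0 < ∑' m : ℕ, ν (((m : ℝ) + 1) / ω) := by linarith
    refine ⟨hω, MonoTest.prior_nonneg hν_nonneg hω, MonoTest.hasSum_prior hT,
      fun k => ?_, fun k => ?_⟩
    · rw [MonoTest.prior_eq, div_le_div_iff₀ hT hω]
      nlinarith [hM (((k : ℝ) + 1) / ω) (by positivity)]
    · rw [MonoTest.prior_eq]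
      exact div_le_div_of_nonneg_left (hν_nonneg _ (by positivity)) hT hT2
  have hL := MonoTest.tendsto_log_log
  constructor
  · intro x ε hε H
    have hc0 : 0 ≤ (1 - α) * (1 - MonoTest.Phi x) :=
      mul_nonneg (by linarith) (by linarith [MonoTest.Phi_lt_one x])
    have hc1 : (1 - α) * (1 - MonoTest.Phi x) ≤ 1 :=
      mul_le_one₀ (by linarith) (by linarith [MonoTest.Phi_lt_one x])
        (by linarith [MonoTest.Phi_pos x])
    refine le_of_forall_pos_le_add fun η hη => ?_
    rw [← sub_le_iff_le_add]
    -- A real `liminf` is meaningful only under a bound from above; the averaged error is at most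
    -- `1`.
    refine le_liminf_of_le (IsCoboundedUnder.of_frequently_le (a := 1) ?_) ?_
    · refine Eventually.frequently ?_
      filter_upwards [hprior] with ω ⟨_, hp, hs, _⟩
      exact MonoTest.avgTypeII_le_one hp hs _ _
    · have H' := (MonoTest.tendsto_div_ofReal_const_mul (half_pos hε) H).eventually
        (gt_mem_nhds (ENNReal.ofReal_pos.2 hη))
      filter_upwards [hprior, H', MonoTest.eventually_le_cellAccept hα0 hα1 (2 * M) x hε,
        hL.eventually_gt_atTop 0] with ω ⟨hω, hp, hs, hpM, _⟩ hsmall hcell hLpos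
      have h := MonoTest.le_avgTypeII (α := α) (σ := σ) (A := A ω) hp hs hc0 hc1
        (mul_pos (half_pos hε) hLpos)
        (g := fun k => (A ω k / MonoTest.noiseLevel σ k - x) ^ 2 + ε * Real.log (Real.log ω)
              - MonoTest.critRatio (MonoTest.critVal α) ω k) fun k hk =>
          MonoTest.le_levelTypeII fun j => by
            refine le_trans ?_ (MonoTest.le_typeII hα0 hα1 hσ hp hs _ _)
            rw [neg_div]
            exact mul_le_mul_of_nonneg_left (hcell _ k _ hp (hpM k) hk) (by linarith)
      have h' := h.trans (add_le_add_right hsmall.le _)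
      rw [← ENNReal.ofReal_add (MonoTest.avgTypeII_nonneg hp _ _) hη.le,
        ENNReal.ofReal_le_ofReal_iff (add_nonneg (MonoTest.avgTypeII_nonneg hp _ _) hη.le)] at h'
      linarith
  · intro ε hε H
    have H' := MonoTest.tendsto_div_ofReal_const_mul (half_pos hε) H
    have hPhi := MonoTest.tendsto_Phi_neg
      (Real.tendsto_sqrt_atTop.comp (hL.const_mul_atTop hε))
    -- The cutoff for `ν` must tend to zero, yet slowly enough to cost less than the gain `exp (-(ε
    -- / 4) log log ω)` in the tail.
    have hδ : Tendsto (fun ω : ℝ => Real.exp (-(ε / 8 * Real.log (Real.log ω)))) atTop (𝓝 0) :=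
      Real.tendsto_exp_neg_atTop_nhds_zero.comp (hL.const_mul_atTop (by positivity))
    have hB := MonoTest.tendsto_prior_small hν_nonneg hν_cont hν_int hν_riemann hδ
    have hbound := ((ENNReal.tendsto_ofReal hPhi).add H').add hB
    rw [ENNReal.ofReal_zero, add_zero, add_zero] at hbound
    have hlim : Tendsto (fun ω : ℝ => ENNReal.ofReal
        (MonoTest.avgTypeII α σ (MonoTest.prior ν ω) (A ω))) atTop (𝓝 0) := by
      refine tendsto_of_tendsto_of_tendsto_of_le_of_le' tendsto_const_nhds hbound
        (Eventually.of_forall fun _ => zero_le) ?_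
      filter_upwards [hprior, MonoTest.eventually_cellAccept_le hα0 hα1 (C := 1 / 2)
        (by norm_num) hε, hL.eventually_gt_atTop 0] with ω ⟨hω, hp, hs, _, hpν⟩ hcell hLpos
      refine MonoTest.avgTypeII_le hp hs (MonoTest.Phi_pos _).le (mul_pos (half_pos hε) hLpos)
        (fun k => ν (((k : ℝ) + 1) / ω) ≤ Real.exp (-(ε / 8 * Real.log (Real.log ω))))
        fun k hk hg => MonoTest.levelTypeII_le fun j => ?_
      refine (MonoTest.typeII_le hα0 hα1 hσ hp _ _).trans ?_
      rw [neg_div]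
      refine hcell _ k _ hp (le_hasSum hs k fun k' _ => hp k') (le_trans ?_ (hpν k))
        (div_nonneg (hA ω k) (MonoTest.noiseLevel_pos hσ k).le) ?_
      · rw [one_div, inv_mul_eq_div, div_div]
        exact div_le_div_of_nonneg_right (not_le.1 hk).le (by positivity)
      · rw [div_pow]
        exact hg
    have hreal := (ENNReal.tendsto_toReal ENNReal.zero_ne_top).comp hlim
    refine hreal.congr' ?_
    filter_upwards [hprior] with ω ⟨_, hp, _⟩
    exact ENNReal.toReal_ofReal (MonoTest.avgTypeII_nonneg hp _ _)
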